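/- For a finite graph $G$ on a non-empty vertex set, its average degree is $\frac{1}{|V(G)|}\sum_{v\in V(G)}\deg_G(v)=\frac{2|E(G)|}{|V(G)|}$, and $G[R]$ denotes the subgraph induced by $R\subseteq V(G)$. For real $\rho$ and a positive integer $r$, call $G$ $(\rho,r)$-sparse if for every $R\subseteq V(G)$ with $|R|\le r$ the graph $G[R]$ has at most $\rho|R|$ edges. All graphs are finite and simple. Then the following two (equivalent) statements hold. (i) For all real numbers $s>2$ and $\varepsilon>0$ there is a positive integer $t=t(s,\varepsilon)$ such that, for all sufficiently large $n$ (in terms of $s$ and $\varepsilon$), every $n$-vertex graph $G$ of average degree at least $n^{1-\frac{2}{s}+\varepsilon}$ contains a non-empty set $R\subseteq V(G)$ with $|R|\le t$ such that $G[R]$ has average degree at least $s$. (ii) For all real numbers $\rho>1$ and $0<\varepsilon<1$ there is a positive integer $r=r(\rho,\varepsilon)$ such that, for all sufficiently large $n$ (in terms of $\rho$ and $\varepsilon$), no $n$-vertex graph $G$ of average degree at least $n^{1-\frac{1}{\rho}+\varepsilon}$ is $(\rho,r)$-sparse. -/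

import Mathlib

namespace DenseSubgraph

open Classical in
/-- The average degree of a finite graph: the arithmetic mean of its vertex degrees
(with value `0` for the graph on the empty vertex set). -/
noncomputable def averageDegree {V : Type*} [Fintype V] (G : SimpleGraph V) : ℝ :=
  (∑ v : V, (G.degree v : ℝ)) / (Fintype.card V : ℝ)

/-- `G` is `(ρ, r)`-sparse: every set `R` of at most `r` vertices spans at most `ρ |R|` edges. -/
def IsSparse {V : Type*} (G : SimpleGraph V) (ρ : ℝ) (r : ℕ) : Prop :=
  ∀ R : Finset V, R.card ≤ r →
    ((G.induce (R : Set V)).edgeSet.ncard : ℝ) ≤ ρ * (R.card : ℝ)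

end DenseSubgraph

/-! Both statements are one claim, with `s = 2ρ`. Take a rational `1 + y = (a + q) / a` slightly
above `ρ` and the caterpillar with `a` spine vertices and `q + 1` leaves, hence `a + q` edges. In a
subgraph `W` of minimum degree about `D + O(1)`, with `D` of order `n ^ (1 - 1/ρ + ε)`, it has at
least `|W| D ^ (a + q)` embeddings but at most `|W| ^ (q + 1)` tuples of leaf images. The exponent
makes `D ^ (a + q)` exceed any constant times `|W| ^ q`, so by pigeonhole many copies share all
their leaves (`exists_dense_of_minDegree`).

The caterpillar is balanced (`caterpillar_balanced`): a copy glued onto a set that contains its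
leaves adds at least `1 + y` edges per new vertex. A union `U` of boundedly many copies therefore
spans at least `(1 + y)(|U| - q - 1)` edges, more than `ρ |U|` once `|U|` is large. -/

namespace DenseSubgraph

open Finset

variable {V : Type*}

/-! ### Spanned edges and minimum degree -/

open Classical in
/-- The edges of `G` with both endpoints in the finite set `U`. -/
noncomputable def spannedEdges (G : SimpleGraph V) (U : Finset V) : Finset (Sym2 V) :=
  U.sym2.filter (· ∈ G.edgeSet)

theorem mem_spannedEdges {G : SimpleGraph V} {U : Finset V} {e : Sym2 V} :
    e ∈ spannedEdges G U ↔ (∀ v ∈ e, v ∈ U) ∧ e ∈ G.edgeSet := by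
  classical
  simp [spannedEdges, Finset.mem_sym2_iff]

theorem mk_mem_spannedEdges {G : SimpleGraph V} {U : Finset V} {x y : V} :
    s(x, y) ∈ spannedEdges G U ↔ (x ∈ U ∧ y ∈ U) ∧ G.Adj x y := by
  simp [mem_spannedEdges]

theorem ncard_edgeSet_induce (G : SimpleGraph V) (U : Finset V) :
    (G.induce (U : Set V)).edgeSet.ncard = (spannedEdges G U).card := by
  rw [← Set.ncard_coe_finset,
    ← Set.ncard_image_of_injective _ (Sym2.map.injective Subtype.val_injective)]
  congr 1
  ext e
  induction e with | _ x y
  simp only [Set.mem_image, Finset.mem_coe, mk_mem_spannedEdges]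
  constructor
  · rintro ⟨e, he, h⟩
    induction e with | _ u v
    rw [SimpleGraph.mem_edgeSet, SimpleGraph.comap_adj] at he
    rw [Sym2.map_mk] at h
    have h' : s(x, y) ∈ spannedEdges G U := by
      rw [← h]
      exact mk_mem_spannedEdges.2 ⟨⟨u.2, v.2⟩, he⟩
    exact mk_mem_spannedEdges.1 h'
  · rintro ⟨⟨hx, hy⟩, hxy⟩
    exact ⟨s(⟨x, hx⟩, ⟨y, hy⟩), hxy, rfl⟩

theorem averageDegree_eq [Fintype V] (G : SimpleGraph V) :
    averageDegree G = 2 * (G.edgeSet.ncard : ℝ) / Fintype.card V := by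
  classical
  unfold averageDegree
  congr 1
  have h := G.sum_degrees_eq_twice_card_edges
  rw [← SimpleGraph.coe_edgeFinset, Set.ncard_coe_finset]
  have h2 : (∑ v, (G.degree v : ℝ)) = 2 * (G.edgeFinset.card : ℝ) := by exact_mod_cast h
  convert h2

theorem card_spannedEdges_univ [Fintype V] (G : SimpleGraph V) :
    (spannedEdges G univ).card = G.edgeSet.ncard := by
  rw [← Set.ncard_coe_finset]
  congr 1
  ext e
  simp [mem_spannedEdges]

open Classical in
theorem card_spannedEdges_le_erase (G : SimpleGraph V) (W : Finset V) (v : V) :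
    (spannedEdges G W).card ≤
      (spannedEdges G (W.erase v)).card + (W.filter (G.Adj v)).card := by
  have h : spannedEdges G W ⊆
      spannedEdges G (W.erase v) ∪ (W.filter (G.Adj v)).image (fun u => s(v, u)) := by
    intro e he
    induction e with | _ x y
    obtain ⟨⟨hx, hy⟩, hxy⟩ := mk_mem_spannedEdges.1 he
    rw [mem_union, mk_mem_spannedEdges, mem_image]
    by_cases hxv : x = v
    · subst hxv
      exact Or.inr ⟨y, by simp [hy, hxy], rfl⟩
    by_cases hyv : y = v
    · subst hyv
      exact Or.inr ⟨x, by simp [hx, hxy.symm], Sym2.eq_swap⟩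
    · exact Or.inl ⟨⟨mem_erase.2 ⟨hxv, hx⟩, mem_erase.2 ⟨hyv, hy⟩⟩, hxy⟩
  calc _ ≤ _ := card_le_card h
    _ ≤ _ := card_union_le _ _
    _ ≤ _ := by gcongr; exact card_image_le

open Classical in
/-- A graph spanning at least `c |W₀|` edges on `W₀` has an induced subgraph of minimum degree
at least `c`. -/
theorem exists_minDegree_subset (G : SimpleGraph V) {c : ℝ} (W₀ : Finset V)
    (hne : W₀.Nonempty) (h₀ : c * W₀.card ≤ (spannedEdges G W₀).card) :
    ∃ W ⊆ W₀, W.Nonempty ∧ ∀ v ∈ W, c ≤ ((W.filter (G.Adj v)).card : ℝ) := by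
  induction W₀ using Finset.strongInduction with
  | H W₀ ih =>
    by_cases hmin : ∀ v ∈ W₀, c ≤ ((W₀.filter (G.Adj v)).card : ℝ)
    · exact ⟨W₀, Subset.rfl, hne, hmin⟩
    · push Not at hmin
      obtain ⟨v, hv, hlt⟩ := hmin
      have hle : ((spannedEdges G W₀).card : ℝ) ≤
          (spannedEdges G (W₀.erase v)).card + (W₀.filter (G.Adj v)).card := by
        exact_mod_cast card_spannedEdges_le_erase G W₀ v
      have hcard : ((W₀.erase v).card : ℝ) + 1 = W₀.card := by
        exact_mod_cast card_erase_add_one hv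
      -- Losing fewer than `c` edges makes the bound strict, which rules out an empty remainder.
      have hgt : c * (W₀.erase v).card < (spannedEdges G (W₀.erase v)).card := by
        rw [← hcard] at h₀
        linarith
      have hne' : (W₀.erase v).Nonempty := by
        rw [nonempty_iff_ne_empty]
        intro h
        rw [h] at hgt
        simp [spannedEdges] at hgt
      obtain ⟨W, hW, h⟩ := ih _ (erase_ssubset hv) hne' hgt.le
      exact ⟨W, hW.trans (erase_subset _ _), h⟩

/-! ### Counting tree embeddings -/

open Classical in
/-- The injective maps `Fin k → W` sending each pair `par j, j` with `0 < j` to an edge of `G`: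
the embeddings in `G[W]` of the tree in which `par j` is the parent of `j`. -/
noncomputable def treeEmbeddings (G : SimpleGraph V) (W : Finset V) (par : ℕ → ℕ) (k : ℕ) :
    Finset (Fin k → V) :=
  (Fintype.piFinset fun _ => W).filter fun f => Function.Injective f ∧
    ∀ i j : Fin k, 0 < (j : ℕ) → par j = i → G.Adj (f i) (f j)

theorem mem_treeEmbeddings {G : SimpleGraph V} {W : Finset V} {par : ℕ → ℕ} {k : ℕ}
    {f : Fin k → V} : f ∈ treeEmbeddings G W par k ↔ (∀ i, f i ∈ W) ∧ Function.Injective f ∧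
      ∀ i j : Fin k, 0 < (j : ℕ) → par j = i → G.Adj (f i) (f j) := by
  classical
  simp [treeEmbeddings]

-- An embedding occupies only `k` vertices, so the image of `par k` keeps at least `D` unused
-- neighbours for vertex `k`.
open Classical in
theorem card_mul_le_card_treeEmbeddings_succ (G : SimpleGraph V) (W : Finset V) (par : ℕ → ℕ)
    {D k : ℕ} (hk : 0 < k) (hpar : ∀ j, 0 < j → par j < j)
    (hdeg : ∀ v ∈ W, D + k ≤ (W.filter (G.Adj v)).card) :
    (treeEmbeddings G W par k).card * D ≤ (treeEmbeddings G W par (k + 1)).card := by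
  have hpk := hpar k hk
  let ext : (Fin k → V) → Finset V := fun f =>
    W.filter (G.Adj (f ⟨par k, hpk⟩)) \ univ.image f
  have hext : ∀ f ∈ treeEmbeddings G W par k, D ≤ (ext f).card := by
    intro f hf
    have h1 := hdeg _ ((mem_treeEmbeddings.1 hf).1 ⟨par k, hpk⟩)
    have h2 : (univ.image f).card ≤ k := by
      simpa using card_image_le (s := (univ : Finset (Fin k))) (f := f)
    have h3 := le_card_sdiff (univ.image f) (W.filter (G.Adj (f ⟨par k, hpk⟩)))
    change D ≤ (W.filter (G.Adj (f ⟨par k, hpk⟩)) \ univ.image f).card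
    omega
  calc (treeEmbeddings G W par k).card * D
      ≤ ∑ f ∈ treeEmbeddings G W par k, (ext f).card := by
        simpa using card_nsmul_le_sum _ _ _ hext
    _ = ((treeEmbeddings G W par k).sigma ext).card := (card_sigma _ _).symm
    _ ≤ _ := by
      refine card_le_card_of_injOn (fun p => Fin.snoc (α := fun _ => V) p.1 p.2) ?_ ?_
      · rintro ⟨f, u⟩ hp
        obtain ⟨hf, hu⟩ := mem_sigma.1 hp
        obtain ⟨hfW, hfi, hfa⟩ := mem_treeEmbeddings.1 hf
        obtain ⟨hu1, hu2⟩ := mem_sdiff.1 hu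
        obtain ⟨huW, hua⟩ := mem_filter.1 hu1
        refine mem_treeEmbeddings.2 ⟨?_, ?_, ?_⟩
        · intro i
          refine Fin.lastCases ?_ (fun i => ?_) i
          · simpa using huW
          · simpa using hfW i
        · refine Fin.snoc_injective_iff.2 ⟨hfi, ?_⟩
          rintro ⟨i, hi⟩
          exact hu2 (mem_image.2 ⟨i, mem_univ _, hi⟩)
        · intro i j
          refine Fin.lastCases ?_ (fun j => ?_) j
          · intro _ hij
            have : i = Fin.castSucc ⟨par k, hpk⟩ := Fin.ext (by simpa using hij.symm)
            subst this
            beta_reduce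
            rw [Fin.snoc_castSucc, Fin.snoc_last]
            exact hua
          · refine Fin.lastCases ?_ (fun i => ?_) i
            · intro hj hij
              have := hpar j (by simpa using hj)
              simp only [Fin.val_castSucc, Fin.val_last] at hij
              omega
            · intro hj hij
              simpa using hfa i j (by simpa using hj) (by simpa using hij)
      · rintro ⟨f, u⟩ _ ⟨g, v⟩ _ h
        obtain ⟨h1, h2⟩ := Fin.snoc_injective2 h
        subst h1; subst h2; rfl

open Classical in
theorem card_mul_pow_le_card_treeEmbeddings (G : SimpleGraph V) (W : Finset V) {par : ℕ → ℕ}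
    {D m : ℕ} (hpar : ∀ j, 0 < j → par j < j)
    (hdeg : ∀ v ∈ W, D + m ≤ (W.filter (G.Adj v)).card) :
    W.card * D ^ m ≤ (treeEmbeddings G W par (m + 1)).card := by
  induction m with
  | zero =>
    rw [pow_zero, mul_one]
    refine card_le_card_of_injOn (fun v _ => v) ?_ ?_
    · intro v hv
      refine mem_treeEmbeddings.2 ⟨fun _ => hv, fun i j _ => by omega, ?_⟩
      intro i j hj
      omega
    · intro v _ w _ h
      exact congrFun h 0
  | succ m ih =>
    calc W.card * D ^ (m + 1) = W.card * D ^ m * D := by ring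
      _ ≤ (treeEmbeddings G W par (m + 1)).card * D := by
        gcongr
        exact ih fun v hv => by have := hdeg v hv; omega
      _ ≤ _ := card_mul_le_card_treeEmbeddings_succ G W par m.succ_pos hpar hdeg

/-! ### Balancedness of the caterpillar -/

/-- The parent function of the caterpillar with spine `0, …, a - 1` and leaves `a, …, a + q`
spread evenly along the spine. -/
def caterpillarParent (a q j : ℕ) : ℕ :=
  if j < a then j - 1 else min ((j - a) * a / q) (a - 1)

theorem caterpillarParent_lt {a q : ℕ} (ha : 0 < a) (j : ℕ) (hj : 0 < j) :
    caterpillarParent a q j < j := by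
  unfold caterpillarParent
  split_ifs
  · omega
  · have := min_le_right ((j - a) * a / q) (a - 1)
    omega

/-- The potential argument for balancedness: scanning the spine of a caterpillar in which the first
`t` spine vertices carry `c t ≈ t q / a` leaves, the edges meeting `S` outnumber `(1 + q / a) |S|`
up to a bounded boundary term. -/
theorem scan_spine {a q : ℕ} {c : ℕ → ℕ} (h0 : c 0 = 0)
    (hl : ∀ t, t * q ≤ a * c t) (hu : ∀ t, a * c t ≤ t * q + a) (S : Finset ℕ) (t : ℕ) :
    ((a : ℤ) + q) * (∑ i ∈ range t, if i ∈ S then 1 else 0) +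
        (if 0 < t ∧ t - 1 ∈ S then (a * c t : ℤ) - t * q - a else 0) ≤
      a * ((∑ i ∈ range t, if 0 < i ∧ (i ∈ S ∨ i - 1 ∈ S) then 1 else 0) +
        ∑ i ∈ range t, if i ∈ S then (c (i + 1) : ℤ) - c i else 0) := by
  induction t with
  | zero => simp
  | succ t ih =>
    simp only [sum_range_succ]
    have hl0 : (t * q : ℤ) ≤ a * c t := by exact_mod_cast hl t
    have hu0 : (a * c t : ℤ) ≤ t * q + a := by exact_mod_cast hu t
    have h0' : t = 0 → (c t : ℤ) = 0 := by rintro rfl; exact_mod_cast h0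
    generalize (∑ i ∈ range t, if i ∈ S then (1 : ℤ) else 0) = n at ih ⊢
    generalize (∑ i ∈ range t, if 0 < i ∧ (i ∈ S ∨ i - 1 ∈ S) then (1 : ℤ) else 0) = p at ih ⊢
    generalize (∑ i ∈ range t, if i ∈ S then (c (i + 1) : ℤ) - c i else 0) = l at ih ⊢
    push_cast
    -- The boundary term lies in `[-a, 0]`. Entering a run of `S` at `t > 0` costs `hu0`, leaving
    -- one costs `hl0`, and continuing one, or starting at `0`, gives equality.
    rcases Nat.eq_zero_or_pos t with ht | ht
    · subst ht
      have := h0' rfl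
      by_cases hS : 0 ∈ S <;> simp [hS, this] at ih ⊢ <;> linarith
    · by_cases hS : t ∈ S <;> by_cases hS' : t - 1 ∈ S <;> simp [hS, hS', ht] at ih ⊢ <;> linarith

/-- Every set `S` of spine vertices of the caterpillar meets at least `(1 + q / a) |S|` edges. -/
theorem caterpillar_balanced {a q : ℕ} (ha : 0 < a) (hq : 0 < q) (S : Finset ℕ)
    (hS : S ⊆ range a) :
    (a + q) * S.card ≤ a * ((range (a + (q + 1))).filter fun j =>
      0 < j ∧ (j ∈ S ∨ caterpillarParent a q j ∈ S)).card := by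
  -- This is `⌈t q / a⌉`: for `t ≤ a`, how many of the first `q` leaves hang from the first `t`
  -- spine vertices.
  set c : ℕ → ℕ := fun t => (t * q + (a - 1)) / a with hc
  have hck : ∀ t k, c t ≤ k ↔ t * q ≤ k * a := by
    intro t k
    rw [hc, Nat.div_le_iff_le_mul_add_pred ha, Nat.mul_comm a k]
    omega
  have hkc : ∀ t k, k < c t ↔ k * a < t * q := by
    intro t k
    have := hck t k
    omega
  have h0 : c 0 = 0 := by simp [hc, ha]
  have hmono : Monotone c := by
    intro s t hst
    simp only [hc]
    gcongr
  have hl : ∀ t, t * q ≤ a * c t := fun t => by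
    rw [Nat.mul_comm a]
    exact (hck t _).1 le_rfl
  have hu : ∀ t, a * c t ≤ t * q + a := fun t => by
    have := Nat.mul_div_le (t * q + (a - 1)) a
    simp only [hc]
    omega
  have hca : c a = q := by
    apply le_antisymm
    · rw [hck, Nat.mul_comm]
    · exact Nat.le_of_mul_le_mul_left (hl a) ha
  have hleaf : ∀ i ∈ range a, ((range q).filter fun k => k * a / q = i).card = c (i + 1) - c i := by
    intro i hi
    rw [← Nat.card_Ico]
    congr 1
    ext k
    have h1 : c (i + 1) ≤ q := hca ▸ hmono (Nat.succ_le_of_lt (mem_range.1 hi))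
    have h2 : k * a / q = i ↔ i * q ≤ k * a ∧ k * a < (i + 1) * q := by
      rw [← Nat.le_div_iff_mul_le hq, ← Nat.div_lt_iff_lt_mul hq]
      omega
    rw [mem_filter, mem_Ico, mem_range, h2, hck, hkc]
    refine and_iff_right_of_imp fun h => ?_
    exact ((hkc _ _).2 h.2).trans_le h1
  have hscan := scan_spine h0 hl hu S a
  rw [hca] at hscan
  have hcardS : (∑ i ∈ range a, if i ∈ S then (1 : ℤ) else 0) = S.card := by
    rw [sum_boole, filter_mem_eq_inter, inter_eq_right.2 hS]
  have hleaves : (∑ i ∈ range a, if i ∈ S then (c (i + 1) : ℤ) - c i else 0) =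
      ∑ k ∈ range q, if k * a / q ∈ S then (1 : ℤ) else 0 := by
    rw [sum_boole, card_eq_sum_card_fiberwise (f := fun k => k * a / q) (t := range a)]
    · push_cast
      refine sum_congr rfl fun i hi => ?_
      rw [filter_filter]
      split_ifs with h
      · rw [← Nat.cast_sub (hmono i.le_succ), ← hleaf i hi]
        congr 2
        ext k
        simp only [mem_filter]
        grind
      · symm
        rw [Nat.cast_eq_zero, card_eq_zero, filter_eq_empty_iff]
        grind
    · intro k hk
      exact hS (mem_filter.1 hk).2
  have hcount : (((range (a + (q + 1))).filter fun j =>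
        0 < j ∧ (j ∈ S ∨ caterpillarParent a q j ∈ S)).card : ℤ) =
      (∑ i ∈ range a, if 0 < i ∧ (i ∈ S ∨ i - 1 ∈ S) then 1 else 0) +
        ((∑ k ∈ range q, if k * a / q ∈ S then (1 : ℤ) else 0) + if a - 1 ∈ S then 1 else 0) := by
    rw [← sum_boole, sum_range_add, sum_range_succ]
    congr 1
    · refine sum_congr rfl fun i hi => ?_
      simp [caterpillarParent, mem_range.1 hi]
    have hnot : ∀ k, a + k ∉ S := fun k h => by
      have := mem_range.1 (hS h)
      omega
    congr 1
    · refine sum_congr rfl fun k hk => ?_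
      have h1 : k * a / q ≤ a - 1 := by
        have : k * a / q < a := by
          rw [Nat.div_lt_iff_lt_mul hq, Nat.mul_comm a]
          exact Nat.mul_lt_mul_of_pos_right (mem_range.1 hk) ha
        omega
      simp [caterpillarParent, hnot, min_eq_left h1, ha]
    · have h1 : a - 1 ≤ q * a / q := by
        rw [Nat.mul_div_cancel_left _ hq]
        omega
      simp [caterpillarParent, hnot, min_eq_right h1, ha]
  rw [← Int.ofNat_le, Nat.cast_mul, Nat.cast_mul, Nat.cast_add, hcount, ← hleaves, ← hcardS, ← add_assoc, mul_add (a : ℤ)]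
  -- If `a - 1 ∈ S`, the final boundary term is `-a`, exactly offset by the extra leaf at the end of
  -- the spine.
  have h := hscan
  simp only [ha, true_and] at h
  split_ifs at h ⊢ <;> linarith

/-! ### Gluing copies along common leaves -/

open Classical in
/-- Adding a copy of the caterpillar whose leaves lie in `U` adds to `U` at least `1 + q / a` edges
for each new vertex. -/
theorem spannedEdges_union_caterpillar {G : SimpleGraph V} {W U : Finset V} {a q : ℕ} (ha : 0 < a)
    (hq : 0 < q) {f : Fin (a + (q + 1)) → V}
    (hf : f ∈ treeEmbeddings G W (caterpillarParent a q) (a + (q + 1)))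
    (hroot : ∀ j, f (Fin.natAdd a j) ∈ U) :
    a * (spannedEdges G U).card + (a + q) * (U ∪ univ.image f).card ≤
      a * (spannedEdges G (U ∪ univ.image f)).card + (a + q) * U.card := by
  obtain ⟨-, hinj, hadj⟩ := mem_treeEmbeddings.1 hf
  set S' : Finset (Fin (a + (q + 1))) := univ.filter fun i => f i ∉ U with hS'
  set S : Finset ℕ := S'.image Fin.val with hS
  have hmemS : ∀ i : Fin (a + (q + 1)), (i : ℕ) ∈ S ↔ f i ∉ U := by
    intro i
    simp [hS, hS', Fin.val_inj]
  have hcardS : S.card = S'.card := card_image_of_injective _ Fin.val_injective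
  have hSa : S ⊆ range a := by
    intro i hi
    obtain ⟨j, hj, rfl⟩ := mem_image.1 hi
    rw [mem_range]
    by_contra! h
    have := hroot ⟨j - a, by omega⟩
    rw [show Fin.natAdd a ⟨(j : ℕ) - a, by omega⟩ = j from Fin.ext (by simp; omega)] at this
    exact (mem_filter.1 hj).2 this
  have hcardU : (U ∪ univ.image f).card = U.card + S.card := by
    have : U ∪ univ.image f = U ∪ S'.image f := by
      ext v
      simp only [mem_union, mem_image, mem_univ, true_and, hS', mem_filter]
      grind
    rw [this, card_union_of_disjoint, card_image_of_injective _ hinj, hcardS]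
    rw [disjoint_right]
    intro v hv
    obtain ⟨i, hi, rfl⟩ := mem_image.1 hv
    exact (mem_filter.1 hi).2
  have hlt : ∀ j : Fin (a + (q + 1)), 0 < (j : ℕ) → caterpillarParent a q j < a + (q + 1) := fun j hj =>
    (caterpillarParent_lt ha j hj).trans j.2
  have hbal := caterpillar_balanced ha hq S hSa
  set J := (range (a + (q + 1))).filter fun j => 0 < j ∧ (j ∈ S ∨ caterpillarParent a q j ∈ S) with hJ
  have hedges : (spannedEdges G U).card + J.card ≤ (spannedEdges G (U ∪ univ.image f)).card := by
    have hf0 : ∀ j ∈ J, ∃ h : j < a + (q + 1), ∃ h' : caterpillarParent a q j < a + (q + 1),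
        0 < j ∧ (f ⟨j, h⟩ ∉ U ∨ f ⟨_, h'⟩ ∉ U) := by
      intro j hj
      obtain ⟨h1, h2, h3⟩ := mem_filter.1 hj
      have h := mem_range.1 h1
      have h' := hlt ⟨j, h⟩ h2
      exact ⟨h, h', h2, h3.imp (hmemS ⟨j, h⟩).1 (hmemS ⟨_, h'⟩).1⟩
    -- The edge from `j` to its parent; the loop is a default never reached on `J`.
    let E : ℕ → Sym2 V := fun j => if h : j < a + (q + 1) ∧ caterpillarParent a q j < a + (q + 1) then
      s(f ⟨j, h.1⟩, f ⟨_, h.2⟩) else s(f ⟨0, by omega⟩, f ⟨0, by omega⟩)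
    have hE : ∀ j (h : j < a + (q + 1)) (h' : caterpillarParent a q j < a + (q + 1)),
        E j = s(f ⟨j, h⟩, f ⟨_, h'⟩) := fun j h h' => dif_pos ⟨h, h'⟩
    have hEinj : Set.InjOn E J := by
      intro i hi j hj hij
      obtain ⟨h1, h1', h10, -⟩ := hf0 i hi
      obtain ⟨h2, h2', h20, -⟩ := hf0 j hj
      rw [hE i h1 h1', hE j h2 h2', Sym2.eq_iff] at hij
      simp only [hinj.eq_iff, Fin.mk.injEq] at hij
      -- If the endpoints matched crosswise, `i` and `j` would be each other's parents.
      have := caterpillarParent_lt (q := q) ha i h10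
      have := caterpillarParent_lt (q := q) ha j h20
      omega
    rw [← card_image_of_injOn hEinj, ← card_union_of_disjoint]
    · apply card_le_card
      apply union_subset
      · intro e he
        rw [mem_spannedEdges] at he ⊢
        exact ⟨fun v hv => mem_union_left _ (he.1 v hv), he.2⟩
      · intro e he
        obtain ⟨j, hj, rfl⟩ := mem_image.1 he
        obtain ⟨h, h', h0, -⟩ := hf0 j hj
        rw [hE j h h', mk_mem_spannedEdges]
        exact ⟨⟨mem_union_right _ (mem_image_of_mem _ (mem_univ _)),
          mem_union_right _ (mem_image_of_mem _ (mem_univ _))⟩, (hadj _ ⟨j, h⟩ h0 rfl).symm⟩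
    · rw [disjoint_right]
      intro e he hU
      obtain ⟨j, hj, rfl⟩ := mem_image.1 he
      obtain ⟨h, h', h0, hn⟩ := hf0 j hj
      rw [hE j h h', mk_mem_spannedEdges] at hU
      tauto
  rw [hcardU]
  have := Nat.mul_le_mul_left a hedges
  linarith

/-- Many copies of the caterpillar sharing all their leaves contain a dense union of boundedly many
copies. -/
theorem exists_dense_union {G : SimpleGraph V} {W : Finset V} {a q : ℕ} (ha : 0 < a)
    (hq : 0 < q) (F : Finset (Fin (a + (q + 1)) → V)) (r : Fin (q + 1) → V)
    (hF : ∀ f ∈ F, f ∈ treeEmbeddings G W (caterpillarParent a q) (a + (q + 1)) ∧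
      ∀ j, f (Fin.natAdd a j) = r j) (J : ℕ)
    (hcard : (q + 1 + (a + (q + 1)) * J) ^ (a + (q + 1)) < F.card) :
    ∃ U : Finset V, (∀ j, r j ∈ U) ∧ J ≤ U.card ∧ U.card ≤ q + 1 + (a + (q + 1)) * J ∧
      (a + q) * U.card ≤ a * (spannedEdges G U).card + (a + q) * (q + 1) := by
  classical
  induction J with
  | zero =>
    have h : (univ.image r).card ≤ q + 1 := by
      simpa using card_image_le (s := (univ : Finset (Fin (q + 1)))) (f := r)
    refine ⟨univ.image r, fun j => mem_image_of_mem _ (mem_univ _), Nat.zero_le _, by simpa using h,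
      ?_⟩
    have := Nat.mul_le_mul_left (a + q) h
    omega
  | succ J ih =>
    have hle : q + 1 + (a + (q + 1)) * J ≤ q + 1 + (a + (q + 1)) * (J + 1) := by
      gcongr
      omega
    obtain ⟨U, hrU, hJU, hUc, hUe⟩ := ih ((Nat.pow_le_pow_left hle _).trans_lt hcard)
    -- `F` outnumbers all maps into `U`, so some copy contributes a new vertex.
    obtain ⟨f, hfF, i, hi⟩ : ∃ f ∈ F, ∃ i, f i ∉ U := by
      by_contra! h
      have h1 : F ⊆ Fintype.piFinset fun _ => U := fun f hf => by
        rw [Fintype.mem_piFinset]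
        exact h f hf
      have h2 := card_le_card h1
      rw [Fintype.card_piFinset_const] at h2
      have h3 := Nat.pow_le_pow_left (hUc.trans hle) (a + (q + 1))
      omega
    obtain ⟨hft, hfr⟩ := hF f hfF
    have hun := spannedEdges_union_caterpillar ha hq hft (U := U) fun j => by
      rw [hfr j]
      exact hrU j
    refine ⟨U ∪ univ.image f, fun j => mem_union_left _ (hrU j), ?_, ?_, ?_⟩
    · have : U ⊂ U ∪ univ.image f := by
        refine Finset.ssubset_iff_subset_ne.2 ⟨subset_union_left, fun h => hi ?_⟩
        rw [h]
        exact mem_union_right _ (mem_image_of_mem _ (mem_univ _))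
      have := card_lt_card this
      omega
    · have h1 : (univ.image f).card ≤ a + (q + 1) := by
        simpa using card_image_le (s := (univ : Finset (Fin (a + (q + 1))))) (f := f)
      have h2 := card_union_le U (univ.image f)
      rw [Nat.mul_add_one]
      omega
    · convert_to _ ≤ a * (spannedEdges G (U ∪ univ.image f)).card + (a + q) * (q + 1)
      linarith

open Classical in
/-- A subset of minimum degree `D + O(1)` with `D ^ (a + q)` large compared to `|W| ^ q` contains a
bounded dense set. -/
theorem exists_dense_of_minDegree {G : SimpleGraph V} {W : Finset V} {a q D J : ℕ} (ha : 0 < a)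
    (hq : 0 < q) (hW : W.Nonempty)
    (hdeg : ∀ v ∈ W, D + (a + q) ≤ (W.filter (G.Adj v)).card)
    (hD : W.card ^ q * (q + 1 + (a + (q + 1)) * J) ^ (a + (q + 1)) < D ^ (a + q)) :
    ∃ U : Finset V, J ≤ U.card ∧ U.card ≤ q + 1 + (a + (q + 1)) * J ∧
      (a + q) * U.card ≤ a * (spannedEdges G U).card + (a + q) * (q + 1) := by
  have hcount := card_mul_pow_le_card_treeEmbeddings G W
    (fun j hj => caterpillarParent_lt (q := q) ha j hj) hdeg
  rw [add_assoc a q 1] at hcount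
  obtain ⟨r, -, hr⟩ := exists_lt_card_fiber_of_mul_lt_card_of_maps_to
    (s := treeEmbeddings G W (caterpillarParent a q) (a + (q + 1)))
    (t := Fintype.piFinset fun _ : Fin (q + 1) => W)
    (f := fun f j => f (Fin.natAdd a j)) (n := (q + 1 + (a + (q + 1)) * J) ^ (a + (q + 1)))
    (fun f hf => Fintype.mem_piFinset.2 fun j => (mem_treeEmbeddings.1 hf).1 _) (by
      rw [Fintype.card_piFinset_const]
      refine lt_of_lt_of_le ?_ hcount
      -- One factor `|W|` of the leaf tuples cancels against the choice of root image.
      rw [pow_succ', mul_assoc]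
      exact Nat.mul_lt_mul_of_pos_left hD hW.card_pos)
  obtain ⟨U, -, h⟩ := exists_dense_union ha hq _ r
    (fun f hf => ⟨(mem_filter.1 hf).1, congrFun (mem_filter.1 hf).2⟩) J hr
  exact ⟨U, h⟩

/-! ### Parameters and conclusion -/

theorem eventually_card_threshold {γ : ℝ} (hγ : 0 < γ) {a q : ℕ} (h : (q : ℝ) < γ * (a + q : ℕ))
    (B : ℕ) : ∃ N : ℕ, 0 < N ∧ ∀ n : ℕ, N ≤ n →
      ((a + q : ℕ) : ℝ) + 1 ≤ (n : ℝ) ^ γ / 4 ∧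
      (n : ℝ) ^ q * B < ((n : ℝ) ^ γ / 4) ^ (a + q) := by
  have h1 := ((tendsto_rpow_atTop hγ).comp tendsto_natCast_atTop_atTop).eventually_ge_atTop
    (4 * (((a + q : ℕ) : ℝ) + 1))
  have h2 := ((tendsto_rpow_atTop (sub_pos.2 h)).comp
    tendsto_natCast_atTop_atTop).eventually_gt_atTop ((4 : ℝ) ^ (a + q) * B)
  obtain ⟨N, hN⟩ := Filter.eventually_atTop.1 (h1.and (h2.and (Filter.eventually_gt_atTop 0)))
  refine ⟨N, (hN N le_rfl).2.2, fun n hn => ?_⟩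
  obtain ⟨h1, h2, h3⟩ := hN n hn
  simp only [Function.comp_apply] at h1 h2
  have hn0 : (0 : ℝ) < n := by exact_mod_cast h3
  refine ⟨by linarith, ?_⟩
  rw [Real.rpow_sub hn0, Real.rpow_natCast, Real.rpow_mul_natCast hn0.le,
    lt_div_iff₀ (by positivity)] at h2
  rw [div_pow, lt_div_iff₀ (by positivity)]
  linarith

/-- Graphs of average degree at least `n ^ (1 - 1 / ρ + ε)` contain sets of bounded size spanning
more than `ρ` edges per vertex. -/
theorem exists_bounded_dense_set {ρ ε : ℝ} (hρ : 1 < ρ) (hε : 0 < ε) :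
    ∃ r : ℕ, 0 < r ∧ ∃ N : ℕ, ∀ n : ℕ, N ≤ n →
      ∀ (V : Type*) [Fintype V] (G : SimpleGraph V), Fintype.card V = n →
        (n : ℝ) ^ (1 - 1 / ρ + ε) ≤ averageDegree G →
          ∃ R : Finset V, R.Nonempty ∧ R.card ≤ r ∧
            ρ * R.card < (G.induce (R : Set V)).edgeSet.ncard := by
  have hρ0 : 0 < ρ := by linarith
  -- The upper end means `1 + y < ρ (1 + ε ρ)`, whence `(1 + y)(1 - ε ρ) < ρ`, which is what `hγq`
  -- needs.
  obtain ⟨y, hy1, hy2⟩ := exists_rat_btwn (show ρ - 1 < ρ - 1 + ε * ρ ^ 2 by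
    have : 0 < ε * ρ ^ 2 := by positivity
    linarith)
  have hy0 : 0 < y := by
    have : (0 : ℝ) < y := by linarith
    exact_mod_cast this
  obtain ⟨a, q, ha, hq, hyq⟩ : ∃ a q : ℕ, 0 < a ∧ 0 < q ∧ (y : ℝ) = q / a := by
    refine ⟨y.den, y.num.toNat, y.den_pos, by simpa using hy0, ?_⟩
    have h1 : ((y.num.toNat : ℤ) : ℝ) = y.num := by
      rw [Int.toNat_of_nonneg (Rat.num_nonneg.2 hy0.le)]
    rw [Rat.cast_def, ← h1, Int.cast_natCast]
  have haR : (0 : ℝ) < a := by exact_mod_cast ha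
  have hyqa : (q : ℝ) = y * a := by rw [hyq]; field_simp
  have hγ : 0 < 1 - 1 / ρ + ε := by
    have : 1 / ρ < 1 := by rw [div_lt_one hρ0]; exact hρ
    linarith
  have hγq : (q : ℝ) < (1 - 1 / ρ + ε) * (a + q : ℕ) := by
    push_cast
    rw [hyqa]
    have h1 : (1 + y) * (1 - ε * ρ) < ρ := by nlinarith
    have h2 : (1 + y) * (1 / ρ - ε) < 1 := by
      rw [show (1 / ρ - ε) = (1 - ε * ρ) / ρ by field_simp, ← mul_div_assoc, div_lt_one hρ0]
      exact h1
    nlinarith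
  -- With `J` vertices the surplus `1 + y - ρ` per vertex outweighs the deficit `(1 + y)(q + 1)`
  -- from the roots.
  obtain ⟨J, hJ⟩ := exists_nat_gt ((1 + (y : ℝ)) * (q + 1) / (1 + y - ρ))
  have hgap : 0 < 1 + (y : ℝ) - ρ := by linarith
  rw [div_lt_iff₀ hgap] at hJ
  have hyR : (0 : ℝ) < y := by exact_mod_cast hy0
  have hJ0 : 0 < J := by
    rcases Nat.eq_zero_or_pos J with h | h
    · subst h
      have : 0 < (1 + (y : ℝ)) * (q + 1) := by positivity
      simp only [Nat.cast_zero, zero_mul] at hJ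
      linarith
    · exact h
  obtain ⟨N, hN0, hN⟩ := eventually_card_threshold hγ hγq
    ((q + 1 + (a + (q + 1)) * J) ^ (a + (q + 1)))
  refine ⟨q + 1 + (a + (q + 1)) * J, by omega, N, fun n hn V _ G hV hG => ?_⟩
  classical
  obtain ⟨hN1, hN2⟩ := hN n hn
  have hn0 : (0 : ℝ) < n := by exact_mod_cast hN0.trans_le hn
  set M : ℝ := (n : ℝ) ^ (1 - 1 / ρ + ε) with hM
  rw [averageDegree_eq, hV, le_div_iff₀ hn0] at hG
  have hne : (univ : Finset V).Nonempty := by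
    rw [← card_pos, card_univ, hV]
    exact hN0.trans_le hn
  obtain ⟨W, -, hW, hdeg⟩ := exists_minDegree_subset G (c := M / 2) univ hne (by
    rw [card_spannedEdges_univ, card_univ, hV]
    linarith)
  have hWn : W.card ≤ n := hV ▸ card_le_univ W
  have hM0 : 0 ≤ M / 4 := by positivity
  -- Of the minimum degree `M / 2`, half goes to `D`; the rest absorbs `a + q` and the rounding.
  obtain ⟨U, hJU, hUc, hUe⟩ := exists_dense_of_minDegree (G := G) (D := ⌈M / 4⌉₊) (J := J)
    ha hq hW (by
      intro v hv
      have h1 := hdeg v hv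
      have h2 := Nat.ceil_lt_add_one hM0
      have h3 : ((⌈M / 4⌉₊ + (a + q) : ℕ) : ℝ) ≤ (W.filter (G.Adj v)).card := by
        rw [Nat.cast_add]
        linarith
      exact_mod_cast h3) (by
      have h1 : ((W.card ^ q * (q + 1 + (a + (q + 1)) * J) ^ (a + (q + 1)) : ℕ) : ℝ) <
          (⌈M / 4⌉₊ ^ (a + q) : ℕ) := by
        rw [Nat.cast_mul, Nat.cast_pow, Nat.cast_pow ⌈M / 4⌉₊]
        have hWq : (W.card : ℝ) ^ q ≤ (n : ℝ) ^ q :=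
          pow_le_pow_left₀ (Nat.cast_nonneg _) (by exact_mod_cast hWn) q
        exact ((mul_le_mul_of_nonneg_right hWq (Nat.cast_nonneg _)).trans_lt hN2).trans_le
          (pow_le_pow_left₀ hM0 (Nat.le_ceil _) _)
      exact_mod_cast h1)
  refine ⟨U, card_pos.1 (hJ0.trans_le hJU), hUc, ?_⟩
  rw [ncard_edgeSet_induce]
  have hUe' : ((a : ℝ) + q) * U.card ≤ a * (spannedEdges G U).card + (a + q) * (q + 1) := by
    exact_mod_cast hUe
  have hax : (a : ℝ) + q = a * (1 + y) := by rw [hyqa]; ring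
  rw [hax, mul_assoc, mul_assoc, ← mul_add] at hUe'
  have h1 := le_of_mul_le_mul_left hUe' haR
  have h2 : (J : ℝ) * (1 + y - ρ) ≤ U.card * (1 + y - ρ) := by gcongr
  linarith

end DenseSubgraph

theorem mainTheorem2 :
    (∀ s : ℝ, 2 < s → ∀ ε : ℝ, 0 < ε →
      ∃ t : ℕ, 0 < t ∧ ∃ N : ℕ, ∀ n : ℕ, N ≤ n →
        ∀ (V : Type*) [Fintype V] (G : SimpleGraph V), Fintype.card V = n →
          (n : ℝ) ^ (1 - 2 / s + ε) ≤ DenseSubgraph.averageDegree G →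
            ∃ R : Finset V, R.Nonempty ∧ R.card ≤ t ∧
              s ≤ DenseSubgraph.averageDegree (G.induce (R : Set V))) ∧
    (∀ ρ : ℝ, 1 < ρ → ∀ ε : ℝ, 0 < ε → ε < 1 →
      ∃ r : ℕ, 0 < r ∧ ∃ N : ℕ, ∀ n : ℕ, N ≤ n →
        ∀ (V : Type*) [Fintype V] (G : SimpleGraph V), Fintype.card V = n →
          (n : ℝ) ^ (1 - 1 / ρ + ε) ≤ DenseSubgraph.averageDegree G →
            ¬ DenseSubgraph.IsSparse G ρ r) := by
  refine ⟨fun s hs ε hε => ?_, fun ρ hρ ε hε _ => ?_⟩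
  · obtain ⟨t, ht, N, hN⟩ := DenseSubgraph.exists_bounded_dense_set
      (show 1 < s / 2 by linarith) hε
    refine ⟨t, ht, N, fun n hn V _ G hV hG => ?_⟩
    rw [show 2 / s = 1 / (s / 2) by rw [one_div_div]] at hG
    obtain ⟨R, hR, hRt, hRe⟩ := hN n hn V G hV hG
    refine ⟨R, hR, hRt, ?_⟩
    have hR0 : (0 : ℝ) < R.card := by exact_mod_cast hR.card_pos
    rw [DenseSubgraph.averageDegree_eq, le_div_iff₀ (by simpa using hR.card_pos)]
    have : (Fintype.card (R : Set V) : ℝ) = R.card := by simp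
    rw [this]
    linarith
  · obtain ⟨r, hr, N, hN⟩ := DenseSubgraph.exists_bounded_dense_set hρ hε
    refine ⟨r, hr, N, fun n hn V _ G hV hG hsp => ?_⟩
    obtain ⟨R, -, hRr, hRe⟩ := hN n hn V G hV hG
    exact absurd (hsp R hRr) (not_le.2 hRe)
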